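/- \textbf{Independence logic.} Let $L$ be a first-order vocabulary. Formulas of independence logic are built from first-order $L$-formulas and independence atoms $t_1\bot_{t_3}t_2$ ($t_1,t_2,t_3$ finite, possibly empty, tuples of $L$-terms) by $\vee,\wedge,\exists x,\forall x$. Let $M$ be an $L$-structure (with non-empty domain). A team $X$ of $M$ is a set of assignments into $M$ with a common finite domain of variables. Put $X(M/x)=\{s(a/x): s\in X,\ a\in M\}$ and, for $F:X\to\mathcal P(M)\setminus\{\emptyset\}$, $X(F/x)=\{s(a/x): s\in X,\ a\in F(s)\}$. Satisfaction $M\models_X\varphi$ is defined by: (1) if $\varphi$ is first-order, $M\models_X\varphi$ iff $M\models_s\varphi$ for all $s\in X$; (2) $M\models_X t_1\bot_{t_3}t_2$ iff for all $s,s'\in X$ giving $t_3$ the same value there is $s''\in X$ giving $t_1$ and $t_3$ the same values as $s$ and $t_2$ the same value as $s'$; (3) $M\models_X\psi\vee\chi$ iff $M\models_Y\psi$ and $M\models_Z\chi$ for some $Y,Z$ with $Y\cup Z=X$; (4) $M\models_X\psi\wedge\chi$ iff $M\models_X\psi$ and $M\models_X\chi$; (5) $M\models_X\exists x\,\psi$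 iff $M\models_{X(F/x)}\psi$ for some $F:X\to\mathcal P(M)\setminus\{\emptyset\}$; (6) $M\models_X\forall x\,\psi$ iff $M\models_{X(M/x)}\psi$. For a sentence $\varphi$, $M\models\varphi$ means that $\varphi$ is satisfied by the team consisting of the empty assignment only. \textbf{Normal form.} A sentence is in normal form if it is $$\varphi=\forall x\,\exists y\Big(\bigwedge_{1\le i\le m}u_i\bot_{w_i}v_i\wedge\theta\Big),$$ where $x,y$ are finite tuples of variables, each variable quantified only once, $u_i,v_i,w_i$ are (possibly empty) tuples of variables from $y$, and $\theta$ is a quantifier-free first-order formula in the variables $xy$. \textbf{Approximations.} Put $p_0=0$ and $p_n=p_{n-1}+m(p_{n-1}+n+1)^2$ for $n\ge1$. For $n\ge 0$ and $-n\le j\le p_n$ let $x_{n,j},y_{n,j}$ be tuples of pairwise distinct new variables of the same lengths as $x,y$. Let $\theta_{n,j}=\theta(x_{n,j}y_{n,j}/xy)$ and $e^i_{n,j}=e_i(x_{n,j}y_{n,j}/xy)$ for $e\in\{u,v,w\}$. Let $\pi^i_{n,j,k}$ be $\bot$ if $w_i$ is empty and $\neg\, w^i_{n,j}=w^i_{n,k}$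 otherwise. Let $\Psi^0=\theta_{0,0}$ and, for $n\ge1$, $$\Psi^n=\bigwedge_{-n\le i\le p_n}\theta_{n,i}\wedge\bigwedge_{-n+1\le i\le p_{n-1}}x_{n,i}y_{n,i}=x_{n-1,i}y_{n-1,i}\wedge\bigwedge_{\substack{1\le i\le m\\ -n\le j,k\le p_{n-1}}}\Big(\pi^i_{n,j,k}\vee\bigvee_{p_{n-1}<l\le p_n}u^i_{n,j}v^i_{n,k}w^i_{n,j}=u^i_{n,l}v^i_{n,l}w^i_{n,l}\Big).$$ The $n$-th approximation of $\varphi$ is the first-order sentence $$\Phi^n=\forall x_{0,0}\exists y_{0,0}\big(\Psi^0\wedge\forall x_{1,-1}\exists y_{1,-1}\exists x_{1,0}\exists y_{1,0}\cdots\exists x_{1,p_1}\exists y_{1,p_1}\big(\Psi^1\wedge\cdots\forall x_{n,-n}\exists y_{n,-n}\exists x_{n,-n+1}\exists y_{n,-n+1}\cdots\exists x_{n,p_n}\exists y_{n,p_n}(\Psi^n)\cdots\big)\big).$$ \textbf{Recursive saturation.} Given an injective numbering of the function symbols and one of the relation symbols of $L$, and the resulting Gödel numbering of formulas, $M$ is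 recursively saturated if it satisfies $$\forall\bar x\Big(\big(\bigwedge_n\exists y\bigwedge_{k\le n}\varphi_k(\bar x,y)\big)\rightarrow\exists y\bigwedge_n\varphi_n(\bar x,y)\Big)$$ whenever $\{\varphi_n(\bar x,y):n\in\mathbb N\}$ is a recursive set of first-order $L$-formulas, $\bar x$ being a finite tuple of variables and $y$ a single variable. \textbf{Corollary.} Let $\varphi$ be a sentence of independence logic in normal form, with approximations $\Phi^n$, $n\in\mathbb N$. If $M$ is a countable recursively saturated model (with respect to some such numbering of the symbols of $L$), or a finite model, then $$M\models\varphi\quad\Longleftrightarrow\quad M\models\Phi^n\text{ for every }n\in\mathbb N.$$ -/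

import Mathlib

universe u v w

namespace IndependenceLogic

open FirstOrder FirstOrder.Language

/-! ### Independence logic with lax team semantics -/

/-- Formulas of independence logic over `L` whose free variables are among the `n` variables
indexed by `Fin n`; a quantifier binds the variable with the last index. -/
inductive IFormula (L : FirstOrder.Language.{u, v}) : ℕ → Type (max u v)
  /-- a first-order formula -/
  | fo {n : ℕ} (φ : L.BoundedFormula Empty n) : IFormula L n
  /-- the independence atom: `t₁` is independent of `t₂` given `t₃` (finite, possibly empty,
  tuples of terms) -/
  | indep {n : ℕ} (t₁ t₃ t₂ : List (L.Term (Empty ⊕ Fin n))) : IFormula L n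
  | or {n : ℕ} (φ ψ : IFormula L n) : IFormula L n
  | and {n : ℕ} (φ ψ : IFormula L n) : IFormula L n
  | ex {n : ℕ} (φ : IFormula L (n + 1)) : IFormula L n
  | all {n : ℕ} (φ : IFormula L (n + 1)) : IFormula L n

/-- A team with domain `Fin n`: a set of assignments of the `n` variables. -/
abbrev Team (M : Type w) (n : ℕ) : Type w := Set (Fin n → M)

/-- The duplicated team `X(M/x)`, where `x` is the new last variable. -/
def Team.duplicate {M : Type w} {n : ℕ} (X : Team M n) : Team M (n + 1) :=
  {t | ∃ s ∈ X, ∃ a : M, t = (Fin.snoc s a : Fin (n + 1) → M)}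

/-- The supplemented team `X(F/x)`, where `x` is the new last variable. -/
def Team.supplement {M : Type w} {n : ℕ} (X : Team M n) (F : (Fin n → M) → Set M) :
    Team M (n + 1) :=
  {t | ∃ s ∈ X, ∃ a ∈ F s, t = (Fin.snoc s a : Fin (n + 1) → M)}

/-- The value of a tuple of terms under an assignment. -/
def tupleValue {L : FirstOrder.Language.{u, v}} {M : Type w} [L.Structure M] {n : ℕ} (s : Fin n → M)
    (t : List (L.Term (Empty ⊕ Fin n))) : List M :=
  t.map fun τ => τ.realize (Sum.elim default s)

/-- Lax team semantics. -/
def IFormula.Satisfies {L : FirstOrder.Language.{u, v}} (M : Type w) [L.Structure M] :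
    {n : ℕ} → IFormula L n → Team M n → Prop
  | _, .fo φ, X => ∀ s ∈ X, φ.Realize default s
  | _, .indep t₁ t₃ t₂, X =>
      ∀ s ∈ X, ∀ s' ∈ X, tupleValue s t₃ = tupleValue s' t₃ →
        ∃ s'' ∈ X, tupleValue s'' t₁ = tupleValue s t₁ ∧ tupleValue s'' t₃ = tupleValue s t₃ ∧
          tupleValue s'' t₂ = tupleValue s' t₂
  | _, .or φ ψ, X => ∃ Y Z, Y ∪ Z = X ∧ φ.Satisfies M Y ∧ ψ.Satisfies M Z
  | _, .and φ ψ, X => φ.Satisfies M X ∧ ψ.Satisfies M X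
  | _, .ex φ, X =>
      ∃ F : (Fin _ → M) → Set M, (∀ s ∈ X, (F s).Nonempty) ∧ φ.Satisfies M (X.supplement F)
  | _, .all φ, X => φ.Satisfies M X.duplicate

/-- A sentence is true in `M` if it is satisfied by the team `{∅}` consisting of the empty
assignment only. -/
def IFormula.TrueIn {L : FirstOrder.Language.{u, v}} (φ : IFormula L 0) (M : Type w) [L.Structure M] : Prop :=
  φ.Satisfies M {default}

/-- Universal quantification of all `k` variables. -/
def IFormula.alls {L : FirstOrder.Language.{u, v}} : (k : ℕ) → IFormula L k → IFormula L 0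
  | 0, φ => φ
  | k + 1, φ => IFormula.alls k φ.all

/-- Existential quantification of the last `k` variables. -/
def IFormula.exs {L : FirstOrder.Language.{u, v}} {n : ℕ} : (k : ℕ) → IFormula L (n + k) → IFormula L n
  | 0, φ => φ
  | k + 1, φ => IFormula.exs k φ.ex

/-! ### First-order building blocks -/

/-- Universal quantification of the last `k` variables. -/
def allsLast {L : FirstOrder.Language.{u, v}} {n : ℕ} :
    (k : ℕ) → L.BoundedFormula Empty (n + k) → L.BoundedFormula Empty n
  | 0, φ => φ
  | k + 1, φ => allsLast k φ.all

/-- Existential quantification of the last `k` variables. -/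
def exsLast {L : FirstOrder.Language.{u, v}} {n : ℕ} :
    (k : ℕ) → L.BoundedFormula Empty (n + k) → L.BoundedFormula Empty n
  | 0, φ => φ
  | k + 1, φ => exsLast k φ.ex

/-- Finite conjunction. -/
def conj {L : FirstOrder.Language.{u, v}} {n : ℕ} (l : List (L.BoundedFormula Empty n)) :
    L.BoundedFormula Empty n :=
  l.foldr (· ⊓ ·) ⊤

/-- Finite disjunction. -/
def disj {L : FirstOrder.Language.{u, v}} {n : ℕ} (l : List (L.BoundedFormula Empty n)) :
    L.BoundedFormula Empty n :=
  l.foldr (· ⊔ ·) ⊥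

/-- Equality of two tuples of variables of the same length. -/
def eqTuple (L : FirstOrder.Language.{u, v}) {n : ℕ} (a b : List (Fin n)) : L.BoundedFormula Empty n :=
  conj ((a.zip b).map fun q =>
    (Term.var (Sum.inr q.1) : L.Term (Empty ⊕ Fin n)).bdEqual (Term.var (Sum.inr q.2)))

/-! ### Normal forms and their approximations -/

/-- The data of a sentence `∀ x ∃ y (⋀ i, u i ⊥_{w i} v i ∧ θ)` in normal form: `x` and `y` are
tuples of `r` and `r'` distinct variables, `u i`, `v i`, `w i` (for `i < m`) are tuples of
variables of `y`, and `θ` is a quantifier-free first-order formula in the variables `x`, `y`. -/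
structure NormalForm (L : FirstOrder.Language.{u, v}) where
  r : ℕ
  r' : ℕ
  m : ℕ
  u : Fin m → List (Fin r')
  v : Fin m → List (Fin r')
  w : Fin m → List (Fin r')
  θ : L.Formula (Fin r ⊕ Fin r')
  isQF : θ.IsQF

namespace NormalForm

variable {L : FirstOrder.Language.{u, v}} (N : NormalForm L)

/-- `θ` with `x`, `y` replaced by the variables given by `f`. -/
def substθ {n : ℕ} (f : Fin N.r ⊕ Fin N.r' → Fin n) : L.BoundedFormula Empty n :=
  BoundedFormula.relabel (n := n) (k := 0) (fun z => Sum.inr (f z)) N.θ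

/-- The variables of `y` as terms, in the context consisting of `x` followed by `y`. -/
def yTerms (l : List (Fin N.r')) : List (L.Term (Empty ⊕ Fin (N.r + N.r'))) :=
  l.map fun c => Term.var (Sum.inr (Fin.natAdd N.r c))

/-- The independence logic sentence `∀ x ∃ y (⋀ i, u i ⊥_{w i} v i ∧ θ)`. -/
def toIFormula : IFormula L 0 :=
  IFormula.alls N.r <| IFormula.exs N.r' <|
    ((List.finRange N.m).map fun i =>
      IFormula.indep (N.yTerms (N.u i)) (N.yTerms (N.w i)) (N.yTerms (N.v i))).foldr
        IFormula.and (IFormula.fo (N.substθ (Sum.elim (Fin.castAdd N.r') (Fin.natAdd N.r))))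

/-- `p 0 = 0` and `p n = p (n-1) + m (p (n-1) + n + 1)²` for `n ≥ 1`. -/
def p : ℕ → ℕ
  | 0 => 0
  | n + 1 => p n + N.m * (p n + (n + 1) + 1) ^ 2

/-- The number of pairs `x_{n,i} y_{n,i}`, `-n ≤ i ≤ p n`, of level `n`. The pair with index `i`
is referred to by `i + n : Fin (N.len n)`. -/
def len (n : ℕ) : ℕ := N.p n + n + 1

/-- The number of variables quantified at the levels below `n`. Level `n` quantifies
`x_{n,-n}`, and then `y_{n,-n}` and the `p n + n` pairs `x_{n,i} y_{n,i}`, `-n < i ≤ p n`. -/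
def off : ℕ → ℕ
  | 0 => 0
  | n + 1 => off n + N.r + (N.r' + (N.p n + n) * (N.r + N.r'))

theorem position_lt (n : ℕ) (a : Fin (N.len n)) (c : Fin (N.r + N.r')) :
    N.off n + a * (N.r + N.r') + c < N.off (n + 1) := by
  have ha : (a : ℕ) ≤ N.p n + n := Nat.lt_succ_iff.mp a.isLt
  have h := Nat.mul_le_mul_right (N.r + N.r') ha
  have hc := c.isLt
  simp only [off]
  omega

theorem succ_lt_len (n : ℕ) (b : Fin (N.len n)) : (b : ℕ) + 1 < N.len (n + 1) := by
  have hb := b.isLt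
  have h : N.p n ≤ N.p (n + 1) := Nat.le_add_right _ _
  simp only [len] at *
  omega

theorem off_le (n : ℕ) : N.off n ≤ N.off (n + 1) := by
  simp only [off]
  omega

/-- The position of the variables of the pair of level `n` with number `a` among all variables
quantified at the levels `≤ n`, in the order of quantification. -/
def pair (n : ℕ) (a : Fin (N.len n)) (z : Fin N.r ⊕ Fin N.r') : Fin (N.off (n + 1)) :=
  ⟨N.off n + a * (N.r + N.r') + finSumFinEquiv z, N.position_lt n a (finSumFinEquiv z)⟩

/-- The variables of a pair of level `n`, in the context of level `n + 1`. -/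
def prevPair (n : ℕ) (b : Fin (N.len n)) (z : Fin N.r ⊕ Fin N.r') : Fin (N.off (n + 1 + 1)) :=
  Fin.castLE (N.off_le (n + 1)) (N.pair n b z)

/-- The tuple `x` followed by `y`. -/
def xy : List (Fin N.r ⊕ Fin N.r') :=
  (List.finRange N.r).map Sum.inl ++ (List.finRange N.r').map Sum.inr

/-- The tuple `e_{n,a}` for a tuple `e` of variables of `y`. -/
def sub (n : ℕ) (e : List (Fin N.r')) (a : Fin (N.len n)) : List (Fin (N.off (n + 1))) :=
  e.map fun c => N.pair n a (Sum.inr c)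

/-- The formula `π^i_{n,j,k}`. -/
def piFormula (n : ℕ) (i : Fin N.m) (j k : Fin (N.len n)) : L.BoundedFormula Empty (N.off (n + 1)) :=
  if N.w i = [] then ⊥ else (eqTuple L (N.sub n (N.w i) j) (N.sub n (N.w i) k)).not

/-- The numbers of the pairs of level `n + 1` with index at most `p n`. -/
def oldPairs (n : ℕ) : List (Fin (N.len (n + 1))) :=
  (List.finRange (N.len (n + 1))).filter fun a => (a : ℕ) ≤ N.p n + (n + 1)

/-- The numbers of the pairs of level `n + 1` with index larger than `p n`. -/
def newPairs (n : ℕ) : List (Fin (N.len (n + 1))) :=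
  (List.finRange (N.len (n + 1))).filter fun a => N.p n + (n + 1) < (a : ℕ)

/-- The formula `Ψ^n`. -/
def psi : (n : ℕ) → L.BoundedFormula Empty (N.off (n + 1))
  | 0 => N.substθ (N.pair 0 ⟨0, Nat.succ_pos _⟩)
  | n + 1 =>
    conj ((List.finRange (N.len (n + 1))).map fun a => N.substθ (N.pair (n + 1) a)) ⊓
    (conj ((List.finRange (N.len n)).map fun (b : Fin (N.len n)) =>
        eqTuple L (N.xy.map (N.pair (n + 1) ⟨b + 1, N.succ_lt_len n b⟩))
          (N.xy.map (N.prevPair n b))) ⊓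
      conj ((List.finRange N.m).flatMap fun i => (N.oldPairs n).flatMap fun j =>
        (N.oldPairs n).map fun k =>
          N.piFormula (n + 1) i j k ⊔
            disj ((N.newPairs n).map fun l =>
              eqTuple L
                (N.sub (n + 1) (N.u i) j ++ N.sub (n + 1) (N.v i) k ++ N.sub (n + 1) (N.w i) j)
                (N.sub (n + 1) (N.u i) l ++ N.sub (n + 1) (N.v i) l ++ N.sub (n + 1) (N.w i) l))))

/-- The quantifier prefix `∀ x_{n,-n} ∃ y_{n,-n} ∃ x_{n,-n+1} ∃ y_{n,-n+1} … ∃ x_{n,p n} ∃ y_{n,p n}`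
of level `n`. -/
def prefixed (n : ℕ) (φ : L.BoundedFormula Empty (N.off (n + 1))) :
    L.BoundedFormula Empty (N.off n) :=
  allsLast N.r (exsLast (N.r' + (N.p n + n) * (N.r + N.r')) φ)

/-- The part of the approximation `Φ^{n+d}` that starts with level `n`. -/
def approxFrom : (d n : ℕ) → L.BoundedFormula Empty (N.off n)
  | 0, n => N.prefixed n (N.psi n)
  | d + 1, n => N.prefixed n (N.psi n ⊓ approxFrom d (n + 1))

/-- The `n`-th approximation `Φ^n`, a first-order sentence. -/
def approx (n : ℕ) : L.Sentence := N.approxFrom n 0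

end NormalForm

/-! ### Recursive saturation -/

/-- A numbering of the function and relation symbols of `L`. -/
structure GodelNumbering (L : FirstOrder.Language.{u, v}) where
  func : (Σ l, L.Functions l) ↪ ℕ
  rel : (Σ l, L.Relations l) ↪ ℕ

namespace GodelNumbering

variable {L : FirstOrder.Language.{u, v}} (G : GodelNumbering L)

/-- The Gödel number of a term. -/
def termCode {n : ℕ} : L.Term (Empty ⊕ Fin n) → ℕ
  | .var (Sum.inl e) => e.elim
  | .var (Sum.inr i) => Nat.pair 0 i
  | .func (l := l) f ts =>
      Nat.pair 1 (Nat.pair (G.func ⟨l, f⟩) (Encodable.encode (List.ofFn fun i => termCode (ts i))))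

/-- The Gödel number of a formula. -/
def code : {n : ℕ} → L.BoundedFormula Empty n → ℕ
  | _, .falsum => Nat.pair 0 0
  | _, .equal t₁ t₂ => Nat.pair 1 (Nat.pair (G.termCode t₁) (G.termCode t₂))
  | _, .rel (l := l) R ts =>
      Nat.pair 2 (Nat.pair (G.rel ⟨l, R⟩)
        (Encodable.encode (List.ofFn fun i => G.termCode (ts i))))
  | _, .imp φ ψ => Nat.pair 3 (Nat.pair (code φ) (code ψ))
  | _, .all φ => Nat.pair 4 (code φ)

/-- A set of formulas in `n` variables is recursive if its set of Gödel numbers is. -/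
def IsRecursive {n : ℕ} (S : Set (L.BoundedFormula Empty n)) : Prop :=
  ComputablePred fun c : ℕ => ∃ φ ∈ S, G.code φ = c

/-- `M` is recursively saturated: for every recursive set `{φ_n(x, y) | n ∈ ℕ}` of first-order
formulas, `x` a finite tuple and `y` a single variable,
`M ⊨ ∀ x ((⋀ n, ∃ y, ⋀ m ≤ n, φ_m(x, y)) → ∃ y, ⋀ n, φ_n(x, y))`. -/
def RecursivelySaturated (M : Type w) [L.Structure M] : Prop :=
  ∀ (k : ℕ) (φ : ℕ → L.BoundedFormula Empty (k + 1)), G.IsRecursive (Set.range φ) →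
    ∀ x : Fin k → M,
      (∀ n, ∃ y : M, ∀ m ≤ n, (φ m).Realize default (Fin.snoc x y : Fin (k + 1) → M)) →
        ∃ y : M, ∀ n, (φ n).Realize default (Fin.snoc x y : Fin (k + 1) → M)

end GodelNumbering

end IndependenceLogic

namespace IndependenceLogic

open FirstOrder FirstOrder.Language

variable {L : FirstOrder.Language.{u, v}} {M : Type w} [L.Structure M]

/-! ### Team semantics of quantifier blocks -/

/-! A universal block expands the initial team to the full team, and under lax semantics an
existential block asks for any team projecting onto the given one. So `φ` is true iff some set `X`
of values of `xy` covers every `x`, satisfies `θ` pointwise and is closed under witnesses for the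
atoms (`IsWitness`, `NormalForm.trueIn_iff`). Given such an `X`, each approximation is won by always
answering inside `X` (`IsWitness.realize_approxFrom`).

Conversely, the approximations are used only through simpler sentences `chain d 0`, which describe a
game of `d` rounds. Each round adds `m + 1` pairs: an answer to the challenge `x`, and for each atom
a witness for the single couple of earlier pairs coded by the number of the round. A won
approximation simulates this game (`realize_chain_of_approxFrom`). Since all rounds have the same
shape, the codes of `chain d t` are primitive recursive in `d` (`isUniform_chain`).

A position from which all finite games can be won has, for every challenge, an answer with the same
property (`Playable`). This interchanges an existential block with an infinite conjunction, which is
justified by recursive saturation, or by the pigeonhole principle if `M` is finite. As `M` is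
countable, one infinite play meets every challenge `x` and every couple of pairs, so its pairs form
the required `X` (`Playable.exists_isWitness`). -/

theorem IFormula.satisfies_alls (k : ℕ) (φ : IFormula L k) :
    (IFormula.alls k φ).Satisfies M {default} ↔ φ.Satisfies M Set.univ := by
  induction k with
  | zero =>
    have h : ({default} : Team M 0) = Set.univ := Set.eq_univ_of_forall fun s => Subsingleton.elim _ _
    rw [IFormula.alls, h]
  | succ k ih =>
    have h : Team.duplicate (Set.univ : Team M k) = Set.univ :=
      Set.eq_univ_of_forall fun s => ⟨Fin.init s, trivial, s (Fin.last k), (Fin.snoc_init_self s).symm⟩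
    rw [IFormula.alls, ih, IFormula.Satisfies, h]

/-- A lax choice function may attach any non-empty set of values to an assignment, so the fibres of
a team over its projection are an admissible choice. Under strict semantics this would fail. -/
theorem IFormula.satisfies_exs {n : ℕ} (k : ℕ) (φ : IFormula L (n + k)) (X : Team M n) :
    (IFormula.exs k φ).Satisfies M X ↔
      ∃ Y : Team M (n + k), (fun s i => s (Fin.castAdd k i)) '' Y = X ∧ φ.Satisfies M Y := by
  induction k with
  | zero =>
    constructor
    · exact fun h => ⟨X, Set.image_id X, h⟩
    · rintro ⟨Y, rfl, h⟩
      rw [show (fun (s : Fin (n + 0) → M) (i : Fin n) => s (Fin.castAdd 0 i)) '' Y = Y from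
        Set.image_id Y]
      exact h
  | succ k ih =>
    rw [IFormula.exs, ih]
    constructor
    · rintro ⟨Y, rfl, F, hF, h⟩
      refine ⟨_, ?_, h⟩
      ext s
      constructor
      · rintro ⟨_, ⟨t, ht, a, -, rfl⟩, rfl⟩
        refine ⟨t, ht, ?_⟩
        funext i
        exact (Fin.snoc_castSucc (α := fun _ => M) a t (Fin.castAdd k i)).symm
      · rintro ⟨t, ht, rfl⟩
        obtain ⟨a, ha⟩ := hF t ht
        refine ⟨_, ⟨t, ht, a, ha, rfl⟩, ?_⟩
        funext i
        exact Fin.snoc_castSucc (α := fun _ => M) a t (Fin.castAdd k i)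
    · rintro ⟨Z, rfl, h⟩
      refine ⟨(Fin.init : (Fin (n + k + 1) → M) → _) '' Z, ?_,
        fun s => {a | (Fin.snoc s a : Fin (n + k + 1) → M) ∈ Z}, ?_, ?_⟩
      · rw [Set.image_image]
        rfl
      · rintro _ ⟨t, ht, rfl⟩
        refine ⟨t (Fin.last _), ?_⟩
        rw [Set.mem_ofPred_eq, Fin.snoc_init_self]
        exact ht
      · refine (congrArg (fun Y => φ.Satisfies M Y) (Set.ext fun t => ?_)).mpr h
        constructor
        · rintro ⟨s, -, a, ha, rfl⟩
          exact ha
        · intro ht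
          have e := Fin.snoc_init_self (α := fun _ => M) t
          refine ⟨Fin.init t, ⟨t, ht, rfl⟩, t (Fin.last _), ?_, e.symm⟩
          rw [Set.mem_ofPred_eq, e]
          exact ht

theorem IFormula.satisfies_foldr_and {n : ℕ} (l : List (IFormula L n)) (φ : IFormula L n)
    (X : Team M n) :
    (l.foldr IFormula.and φ).Satisfies M X ↔ (∀ ψ ∈ l, ψ.Satisfies M X) ∧ φ.Satisfies M X := by
  induction l with
  | nil => simp
  | cons a l ih => simp [IFormula.Satisfies, ih, and_assoc]

/-! ### First-order building blocks -/

theorem realize_allsLast {n : ℕ} (k : ℕ) (φ : L.BoundedFormula Empty (n + k)) (s : Fin n → M) :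
    (allsLast k φ).Realize default s ↔
      ∀ x : Fin k → M, φ.Realize default (Fin.append s x) := by
  induction k with
  | zero =>
    rw [allsLast, (Equiv.refl _).forall_congr_left, Unique.forall_iff,
      Fin.append_right_nil _ _ rfl]
    rfl
  | succ k ih =>
    rw [allsLast, ih]
    simp only [BoundedFormula.realize_all]
    constructor
    · intro h x
      have := h (Fin.init x) (x (Fin.last k))
      rwa [← Fin.append_snoc, Fin.snoc_init_self] at this
    · intro h x a
      have := h (Fin.snoc x a)
      rwa [Fin.append_snoc] at this

theorem realize_exsLast {n : ℕ} (k : ℕ) (φ : L.BoundedFormula Empty (n + k)) (s : Fin n → M) :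
    (exsLast k φ).Realize default s ↔
      ∃ x : Fin k → M, φ.Realize default (Fin.append s x) := by
  induction k with
  | zero =>
    rw [exsLast, (Equiv.refl _).exists_congr_left, Unique.exists_iff,
      Fin.append_right_nil _ _ rfl]
    rfl
  | succ k ih =>
    rw [exsLast, ih]
    simp only [BoundedFormula.realize_ex]
    constructor
    · rintro ⟨x, a, h⟩
      refine ⟨Fin.snoc x a, ?_⟩
      rwa [Fin.append_snoc]
    · rintro ⟨x, h⟩
      refine ⟨Fin.init x, x (Fin.last k), ?_⟩
      rwa [← Fin.append_snoc, Fin.snoc_init_self]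

theorem realize_conj {n : ℕ} (l : List (L.BoundedFormula Empty n)) (s : Fin n → M) :
    (conj l).Realize default s ↔ ∀ φ ∈ l, φ.Realize default s :=
  BoundedFormula.realize_foldr_inf l default s

theorem realize_disj {n : ℕ} (l : List (L.BoundedFormula Empty n)) (s : Fin n → M) :
    (disj l).Realize default s ↔ ∃ φ ∈ l, φ.Realize default s :=
  BoundedFormula.realize_foldr_sup l default s

theorem realize_eqTuple_append {n : ℕ} {a b a' b' : List (Fin n)} (h : a.length = b.length)
    (s : Fin n → M) :
    (eqTuple L (a ++ a') (b ++ b')).Realize default s ↔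
      (eqTuple L a b).Realize default s ∧ (eqTuple L a' b').Realize default s := by
  simp only [eqTuple, realize_conj, List.zip_append h, List.map_append, List.mem_append]
  grind

theorem realize_eqTuple_map {n : ℕ} {ι : Type*} (e : List ι) (f g : ι → Fin n) (s : Fin n → M) :
    (eqTuple L (e.map f) (e.map g)).Realize default s ↔ ∀ c ∈ e, s (f c) = s (g c) := by
  simp [eqTuple, realize_conj, List.zip_map', BoundedFormula.realize_bdEqual]

/-- The assignment with values `s`, read off a sequence of values. -/
def restrict {M : Type w} (n : ℕ) (V : ℕ → M) : Fin n → M := fun i => V i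

/-- Carrying assignments as infinite sequences makes positions plain natural numbers, so a longer
context needs no transport between the types `Fin n`. -/
theorem exists_restrict_eq {M : Type w} {n : ℕ} (V : ℕ → M) (t : Fin n → M) :
    ∃ V' : ℕ → M, restrict n V' = t :=
  ⟨fun i => if h : i < n then t ⟨i, h⟩ else V i, by
    funext i
    simp [restrict]⟩

namespace NormalForm

variable (N : NormalForm L)

/-- The quantifier prefix `∀ x ∃ y ∃ x₁ ∃ y₁ … ∃ x_K ∃ y_K`. -/
def block {n : ℕ} (K : ℕ) (φ : L.BoundedFormula Empty (n + N.r + (N.r' + K * (N.r + N.r')))) :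
    L.BoundedFormula Empty n :=
  allsLast N.r (exsLast (N.r' + K * (N.r + N.r')) φ)

theorem append_append_restrict {M : Type w} (n a b : ℕ) (V : ℕ → M) (x : Fin a → M) (y : Fin b → M) :
    ∃ V' : ℕ → M, restrict _ V' = Fin.append (Fin.append (restrict n V) x) y ∧
      (∀ i < n, V' i = V i) ∧ ∀ c : Fin a, V' (n + c) = x c := by
  obtain ⟨V', hV'⟩ := exists_restrict_eq V (Fin.append (Fin.append (restrict n V) x) y)
  refine ⟨V', hV', fun i hi => ?_, fun c => ?_⟩
  · have := congrFun hV' (Fin.castAdd b (Fin.castAdd a ⟨i, hi⟩))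
    rwa [Fin.append_left, Fin.append_left] at this
  · have := congrFun hV' (Fin.castAdd b (Fin.natAdd n c))
    rwa [Fin.append_left, Fin.append_right] at this

/-- With `K = p n + n` the block is definitionally the prefix of level `n` of an approximation, with
`K = m` that of a round, so both games are unfolded by this lemma. -/
theorem realize_block {n : ℕ} (K : ℕ)
    (φ : L.BoundedFormula Empty (n + N.r + (N.r' + K * (N.r + N.r')))) (V : ℕ → M) :
    (N.block K φ).Realize default (restrict n V) ↔
      ∀ x : Fin N.r → M, ∃ V' : ℕ → M, (∀ i < n, V' i = V i) ∧ (∀ c : Fin N.r, V' (n + c) = x c) ∧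
        φ.Realize default (restrict _ V') := by
  simp only [block, realize_allsLast, realize_exsLast]
  refine forall_congr' fun x => ⟨?_, ?_⟩
  · rintro ⟨y, hy⟩
    obtain ⟨V', h, h1, h2⟩ := append_append_restrict n _ _ V x y
    exact ⟨V', h1, h2, h ▸ hy⟩
  · rintro ⟨V', h1, h2, h⟩
    refine ⟨fun i => V' (n + N.r + i), ?_⟩
    convert h
    rw [← Fin.append_castAdd_natAdd (f := restrict _ V'),
      ← Fin.append_castAdd_natAdd (f := fun i => restrict _ V' (Fin.castAdd _ i))]
    congr 2
    · funext i
      exact (h1 i i.isLt).symm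
    · funext c
      exact (h2 c).symm

/-! ### Pairs of values of `x`, `y` -/

/-- The values of the `a`-th pair of tuples after position `b`. -/
def pairAt {M : Type w} (V : ℕ → M) (b a : ℕ) : Fin N.r ⊕ Fin N.r' → M :=
  fun z => V (b + a * (N.r + N.r') + finSumFinEquiv z)

/-- The tuples `e` of variables of `y` have the same values. -/
def Agree {M : Type w} {N : NormalForm L} (e : List (Fin N.r')) (P Q : Fin N.r ⊕ Fin N.r' → M) :
    Prop :=
  ∀ c ∈ e, P (Sum.inr c) = Q (Sum.inr c)

theorem exists_pairAt_eq {M : Type w} (n : ℕ) (V : ℕ → M) (q : ℕ → Fin N.r ⊕ Fin N.r' → M) :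
    ∃ V' : ℕ → M, (∀ i < n, V' i = V i) ∧ ∀ a, N.pairAt V' n a = q a := by
  by_cases h : 0 < N.r + N.r'
  · refine ⟨fun i => if i < n then V i else q ((i - n) / (N.r + N.r'))
      (finSumFinEquiv.symm ⟨(i - n) % (N.r + N.r'), Nat.mod_lt _ h⟩), fun i hi => if_pos hi,
      fun a => funext fun z => ?_⟩
    have hz := (finSumFinEquiv z).isLt
    have e : n + a * (N.r + N.r') + (finSumFinEquiv z : ℕ) - n =
      finSumFinEquiv z + (N.r + N.r') * a := by
      rw [Nat.mul_comm]
      omega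
    have h1 : (finSumFinEquiv z + (N.r + N.r') * a) / (N.r + N.r') = a := by
      rw [Nat.add_mul_div_left _ _ h, Nat.div_eq_of_lt hz, Nat.zero_add]
    have h2 : (finSumFinEquiv z + (N.r + N.r') * a) % (N.r + N.r') = finSumFinEquiv z := by
      rw [Nat.add_mul_mod_self_left, Nat.mod_eq_of_lt hz]
    simp only [pairAt]
    rw [if_neg (by omega)]
    simp only [e, h1, h2, Fin.eta, Equiv.symm_apply_apply]
  -- Without variables a pair has no components, and there is nothing to place.
  · refine ⟨V, fun _ _ => rfl, fun a => funext fun z => ?_⟩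
    exact absurd (Nat.zero_le _ |>.trans_lt (finSumFinEquiv z).isLt) h

theorem realize_substθ {n : ℕ} (f : Fin N.r ⊕ Fin N.r' → Fin n) (s : Fin n → M) :
    (N.substθ f).Realize default s ↔ N.θ.Realize (s ∘ f) := by
  rw [substθ]
  refine (BoundedFormula.realize_relabel (m := n) (n := 0) (φ := N.θ)
    (g := fun z => (Sum.inr (f z) : Empty ⊕ Fin n))).trans ?_
  rw [Formula.Realize]
  refine iff_of_eq (congrArg₂ _ ?_ (Subsingleton.elim _ _))
  funext z
  rfl

/-- A set of values of `x y` that witnesses the truth of `∀ x ∃ y (⋀ i, u i ⊥_{w i} v i ∧ θ)`. -/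
structure IsWitness {M : Type w} [L.Structure M] (X : Set (Fin N.r ⊕ Fin N.r' → M)) : Prop where
  total : ∀ x : Fin N.r → M, ∃ P ∈ X, ∀ c, P (Sum.inl c) = x c
  realize : ∀ P ∈ X, N.θ.Realize P
  indep : ∀ i, ∀ P ∈ X, ∀ Q ∈ X, Agree (N.w i) P Q →
    ∃ T ∈ X, Agree (N.u i) P T ∧ Agree (N.v i) Q T ∧ Agree (N.w i) P T

theorem tupleValue_yTerms (s s' : Fin (N.r + N.r') → M) (e : List (Fin N.r')) :
    tupleValue s (N.yTerms e) = tupleValue s' (N.yTerms e) ↔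
      Agree e (s ∘ finSumFinEquiv) (s' ∘ finSumFinEquiv) := by
  simp [tupleValue, yTerms, Agree, Function.comp_def]

theorem trueIn_iff : N.toIFormula.TrueIn M ↔ ∃ X, N.IsWitness (M := M) X := by
  have hθ : ∀ s : Fin (N.r + N.r') → M,
      (N.substθ (Sum.elim (Fin.castAdd N.r') (Fin.natAdd N.r))).Realize default s ↔
        N.θ.Realize (s ∘ finSumFinEquiv) := by
    intro s
    rw [realize_substθ]
    refine iff_of_eq (congrArg _ (funext fun z => ?_))
    cases z <;> simp
  simp only [IFormula.TrueIn, toIFormula, IFormula.satisfies_alls, IFormula.satisfies_exs,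
    IFormula.satisfies_foldr_and, List.forall_mem_map, List.mem_finRange, forall_const,
    IFormula.Satisfies, tupleValue_yTerms, hθ]
  constructor
  · rintro ⟨Y, hY, hi, ht⟩
    refine ⟨(fun s => s ∘ finSumFinEquiv) '' Y, ?_, ?_, ?_⟩
    · intro x
      obtain ⟨s, hs, rfl⟩ : x ∈ _ '' Y := hY ▸ Set.mem_univ x
      exact ⟨_, ⟨s, hs, rfl⟩, fun c => by simp⟩
    · rintro _ ⟨s, hs, rfl⟩
      exact ht s hs
    · rintro i _ ⟨s, hs, rfl⟩ _ ⟨s', hs', rfl⟩ h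
      obtain ⟨s'', h'', h1, h2, h3⟩ := hi i s hs s' hs' h
      exact ⟨_, ⟨s'', h'', rfl⟩, fun c hc => (h1 c hc).symm, fun c hc => (h3 c hc).symm,
        fun c hc => (h2 c hc).symm⟩
  · rintro ⟨X, hX⟩
    refine ⟨{s | s ∘ finSumFinEquiv ∈ X}, ?_, ?_, fun s hs => hX.realize _ hs⟩
    · refine Set.eq_univ_of_forall fun x => ?_
      obtain ⟨P, hP, h⟩ := hX.total x
      refine ⟨P ∘ finSumFinEquiv.symm, ?_, funext fun c => ?_⟩
      · simpa [Function.comp_assoc] using hP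
      · simpa using h c
    · intro i s hs s' hs' h
      obtain ⟨T, hT, h1, h2, h3⟩ := hX.indep i _ hs _ hs' h
      have e : (T ∘ finSumFinEquiv.symm) ∘ finSumFinEquiv = T := by simp [Function.comp_assoc]
      refine ⟨T ∘ finSumFinEquiv.symm, ?_, ?_, ?_, ?_⟩
      · rwa [Set.mem_ofPred_eq, e]
      all_goals rw [e]
      exacts [fun c hc => (h1 c hc).symm, fun c hc => (h3 c hc).symm, fun c hc => (h2 c hc).symm]

/-! ### The approximations of a true sentence -/

theorem pairAt_inl {M : Type w} (V : ℕ → M) (b : ℕ) (c : Fin N.r) :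
    N.pairAt V b 0 (Sum.inl c) = V (b + c) := by
  simp [pairAt]

theorem pairAt_congr {M : Type w} {V V' : ℕ → M} {n b a : ℕ} (h : ∀ i < n, V' i = V i)
    (ha : b + (a + 1) * (N.r + N.r') ≤ n) : N.pairAt V' b a = N.pairAt V b a := by
  funext z
  have hz := (finSumFinEquiv z).isLt
  refine h _ ?_
  rw [Nat.add_mul, Nat.one_mul] at ha
  omega

theorem pair_end_le (n a : ℕ) (ha : a < N.len n) :
    N.off n + (a + 1) * (N.r + N.r') ≤ N.off (n + 1) := by
  have h : (a + 1) * (N.r + N.r') ≤ (N.p n + n + 1) * (N.r + N.r') :=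
    Nat.mul_le_mul_right _ ha
  rw [Nat.add_mul (N.p n + n)] at h
  simp only [off]
  omega

theorem realize_psi_zero (V : ℕ → M) :
    (N.psi 0).Realize default (restrict _ V) ↔ N.θ.Realize (N.pairAt V (N.off 0) 0) :=
  N.realize_substθ _ _

/-- Numbers are indices shifted by the level, so the pair numbered `b` reappears as `b + 1` one
level later. For empty `w i`, `Agree` is vacuously true, which matches the case `⊥` of `piFormula`.
-/
theorem realize_psi_succ (n : ℕ) (V : ℕ → M) :
    (N.psi (n + 1)).Realize default (restrict _ V) ↔
      (∀ a < N.len (n + 1), N.θ.Realize (N.pairAt V (N.off (n + 1)) a)) ∧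
      (∀ b < N.len n, N.pairAt V (N.off (n + 1)) (b + 1) = N.pairAt V (N.off n) b) ∧
      ∀ i, ∀ j ≤ N.p n + (n + 1), ∀ k ≤ N.p n + (n + 1),
        Agree (N.w i) (N.pairAt V (N.off (n + 1)) j) (N.pairAt V (N.off (n + 1)) k) →
        ∃ l < N.len (n + 1), N.p n + (n + 1) < l ∧
          Agree (N.u i) (N.pairAt V (N.off (n + 1)) j) (N.pairAt V (N.off (n + 1)) l) ∧
          Agree (N.v i) (N.pairAt V (N.off (n + 1)) k) (N.pairAt V (N.off (n + 1)) l) ∧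
          Agree (N.w i) (N.pairAt V (N.off (n + 1)) j) (N.pairAt V (N.off (n + 1)) l) := by
  have hle : ∀ j, j ≤ N.p n + (n + 1) → j < N.len (n + 1) := by
    intro j hj
    have h : N.p n ≤ N.p (n + 1) := Nat.le_add_right _ _
    simp only [len]
    omega
  have hpi : ∀ i (j k : Fin (N.len (n + 1))),
      (N.piFormula (n + 1) i j k).Realize default (restrict _ V) ↔
        ¬ Agree (N.w i) (N.pairAt V (N.off (n + 1)) j) (N.pairAt V (N.off (n + 1)) k) := by
    intro i j k
    unfold piFormula
    split_ifs with h
    · simp [h, Agree]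
    · rw [BoundedFormula.realize_not, sub, sub, realize_eqTuple_map]
      rfl
  have hxy : ∀ f g : Fin N.r ⊕ Fin N.r' → Fin (N.off (n + 1 + 1)),
      (eqTuple L (N.xy.map f) (N.xy.map g)).Realize default (restrict _ V) ↔
        restrict _ V ∘ f = restrict _ V ∘ g := by
    intro f g
    rw [realize_eqTuple_map, funext_iff]
    refine forall_congr' fun z => ?_
    have hz : z ∈ N.xy := by cases z <;> simp [xy]
    simp [hz]
  rw [psi]
  simp only [BoundedFormula.realize_inf, realize_conj, List.forall_mem_map, List.mem_finRange, forall_const, List.mem_flatMap, realize_substθ, hxy,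
    true_and]
  refine and_congr ?_ (and_congr ?_ ?_)
  · exact ⟨fun h a ha => h ⟨a, ha⟩, fun h a => h a a.isLt⟩
  · exact ⟨fun h a ha => h ⟨a, ha⟩, fun h a => h a a.isLt⟩
  · constructor
    · intro h i j hj k hk hw
      rcases BoundedFormula.realize_sup.1 <| h _ ⟨i, ⟨j, hle j hj⟩, by simpa [oldPairs] using hj,
        List.mem_map.2 ⟨⟨k, hle k hk⟩, by simpa [oldPairs] using hk, rfl⟩⟩ with h | h
      · exact absurd hw ((hpi _ _ _).1 h)
      · obtain ⟨_, hmem, h⟩ := (realize_disj _ _).1 h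
        obtain ⟨l, hl, rfl⟩ := List.mem_map.1 hmem
        rw [realize_eqTuple_append (by simp [sub]), realize_eqTuple_append (by simp [sub]), sub, sub,
          sub, sub, sub, sub, realize_eqTuple_map, realize_eqTuple_map, realize_eqTuple_map,
          and_assoc] at h
        exact ⟨l, l.isLt, by simpa [newPairs] using hl, h⟩
    · rintro h φ ⟨i, j, hj, hφ⟩
      obtain ⟨k, hk, rfl⟩ := List.mem_map.1 hφ
      rw [BoundedFormula.realize_sup, hpi, ← imp_iff_not_or, realize_disj]
      intro hw
      obtain ⟨l, hl, hl', h⟩ := h i j (by simpa [oldPairs] using hj) k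
        (by simpa [oldPairs] using hk) hw
      refine ⟨_, List.mem_map.2 ⟨⟨l, hl⟩, by simpa [newPairs] using hl', rfl⟩, ?_⟩
      rw [realize_eqTuple_append (by simp [sub]), realize_eqTuple_append (by simp [sub]), sub, sub,
        sub, sub, sub, sub, realize_eqTuple_map, realize_eqTuple_map, realize_eqTuple_map,
        and_assoc]
      exact h

variable {N}

/-- The answer inside `X`: number `0` goes to an element above the challenge `x`, the next numbers
repeat the previous level, and the rest supply witnesses. At level `0`, `hV` is void. -/
theorem IsWitness.exists_extension {X : Set (Fin N.r ⊕ Fin N.r' → M)} (hX : N.IsWitness X) (n : ℕ)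
    (V : ℕ → M) (hV : ∀ m, n = m + 1 → ∀ a < N.len m, N.pairAt V (N.off m) a ∈ X)
    (x : Fin N.r → M) :
    ∃ V' : ℕ → M, (∀ i < N.off n, V' i = V i) ∧ (∀ c : Fin N.r, V' (N.off n + c) = x c) ∧
      (N.psi n).Realize default (restrict _ V') ∧
      ∀ a < N.len n, N.pairAt V' (N.off n) a ∈ X := by
  obtain ⟨P, hP, hPx⟩ := hX.total x
  cases n with
  | zero =>
    obtain ⟨V', h1, h2⟩ := N.exists_pairAt_eq (N.off 0) V fun _ => P
    refine ⟨V', h1, fun c => ?_, ?_, fun a _ => by rwa [h2]⟩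
    · rw [← N.pairAt_inl V', h2, hPx]
    · rw [realize_psi_zero, h2]
      exact hX.realize _ hP
  | succ m =>
    have hV := hV m rfl
    obtain ⟨old, hold⟩ : ∃ old : ℕ → Fin N.r ⊕ Fin N.r' → M,
        old = fun a => if a = 0 then P else N.pairAt V (N.off m) (a - 1) := ⟨_, rfl⟩
    have hold0 : old 0 = P := by simp [hold]
    have hold1 : ∀ b, old (b + 1) = N.pairAt V (N.off m) b := fun b => by simp [hold]
    have holdX : ∀ a < N.len m + 1, old a ∈ X := by
      rintro (_ | a) ha
      · rwa [hold0]
      · rw [hold1]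
        exact hV a (by omega)
    -- Where the two pairs disagree on `w`, any element of `X` serves, so `T` can be total.
    have hT : ∀ c : Fin N.m × (Fin (N.len m + 1) × Fin (N.len m + 1)), ∃ T ∈ X,
        Agree (N.w c.1) (old c.2.1) (old c.2.2) →
          Agree (N.u c.1) (old c.2.1) T ∧ Agree (N.v c.1) (old c.2.2) T ∧
            Agree (N.w c.1) (old c.2.1) T := by
      intro c
      by_cases h : Agree (N.w c.1) (old c.2.1) (old c.2.2)
      · obtain ⟨T, hT, h'⟩ := hX.indep c.1 _ (holdX _ c.2.1.isLt) _ (holdX _ c.2.2.isLt) h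
        exact ⟨T, hT, fun _ => h'⟩
      · exact ⟨P, hP, fun h' => absurd h' h⟩
    choose T hT hT' using hT
    -- The recursion for `p` leaves exactly one new place for each triple `(i, j, k)` of an atom and
    -- two old pairs; `e` assigns these places.
    have hlen : N.len (m + 1) = N.len m + 1 + N.m * (N.len m + 1) ^ 2 := by
      simp only [len, p, ← Nat.add_assoc]
      omega
    obtain ⟨e⟩ : Nonempty (Fin (N.m * (N.len m + 1) ^ 2) ≃
        Fin N.m × (Fin (N.len m + 1) × Fin (N.len m + 1))) := by
      refine ⟨Fintype.equivOfCardEq ?_⟩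
      simp [sq]
    obtain ⟨V', h1, h2⟩ := N.exists_pairAt_eq (N.off (m + 1)) V fun a =>
      if a < N.len m + 1 then old a else
        if h : a - (N.len m + 1) < N.m * (N.len m + 1) ^ 2 then T (e ⟨_, h⟩) else P
    have h2old : ∀ a < N.len m + 1, N.pairAt V' (N.off (m + 1)) a = old a := by
      intro a ha
      rw [h2, if_pos ha]
    have h2X : ∀ a, N.pairAt V' (N.off (m + 1)) a ∈ X := by
      intro a
      rw [h2]
      split_ifs with h h'
      exacts [holdX a h, hT _, hP]
    refine ⟨V', h1, fun c => ?_, ?_, fun a _ => h2X a⟩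
    · rw [← N.pairAt_inl V', h2old _ (Nat.succ_pos _), hold0, hPx]
    · rw [realize_psi_succ]
      refine ⟨fun a _ => hX.realize _ (h2X a), fun b hb => ?_, fun i j hj k hk hw => ?_⟩
      · rw [h2old _ (by omega), hold1]
        exact (N.pairAt_congr h1 (N.pair_end_le m b hb)).symm
      · have hj : j < N.len m + 1 := Nat.lt_succ_of_le hj
        have hk : k < N.len m + 1 := Nat.lt_succ_of_le hk
        have hl := (e.symm (i, ⟨j, hj⟩, ⟨k, hk⟩)).isLt
        have hl2 : N.pairAt V' (N.off (m + 1))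
            (N.len m + 1 + (e.symm (i, ⟨j, hj⟩, ⟨k, hk⟩) : Fin _)) =
            T (i, ⟨j, hj⟩, ⟨k, hk⟩) := by
          rw [h2, if_neg (by omega)]
          simp only [Nat.add_sub_cancel_left, hl, dite_true, Fin.eta, Equiv.apply_symm_apply]
        refine ⟨N.len m + 1 + (e.symm (i, ⟨j, hj⟩, ⟨k, hk⟩) : Fin _), ?_, ?_⟩
        · rw [hlen]
          omega
        · rw [hl2, h2old j hj, h2old k hk] at *
          refine ⟨?_, hT' (i, ⟨j, hj⟩, ⟨k, hk⟩) hw⟩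
          simp only [len]
          omega

theorem IsWitness.realize_approxFrom {X : Set (Fin N.r ⊕ Fin N.r' → M)} (hX : N.IsWitness X)
    (d n : ℕ) (V : ℕ → M) (hV : ∀ m, n = m + 1 → ∀ a < N.len m, N.pairAt V (N.off m) a ∈ X) :
    (N.approxFrom d n).Realize default (restrict _ V) := by
  induction d generalizing n V with
  | zero =>
    refine (N.realize_block _ _ V).2 fun x => ?_
    obtain ⟨V', h1, h2, h3, -⟩ := hX.exists_extension n V hV x
    exact ⟨V', h1, h2, h3⟩
  | succ d ih =>
    refine (N.realize_block _ _ V).2 fun x => ?_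
    obtain ⟨V', h1, h2, h3, h4⟩ := hX.exists_extension n V hV x
    refine ⟨V', h1, h2, BoundedFormula.realize_inf.2 ⟨h3, ih (n + 1) V' ?_⟩⟩
    rintro m hm a ha
    obtain rfl : n = m := Nat.succ_injective hm
    exact h4 a ha

variable (N)

theorem realize_approx_iff (n : ℕ) (V : ℕ → M) :
    Sentence.Realize M (N.approx n) ↔ (N.approxFrom n 0).Realize default (restrict _ V) := by
  have h : restrict (N.off 0) V = (default : Fin 0 → M) := funext fun i => i.elim0
  rw [h]
  exact Iff.rfl

/-! ### Scheduled approximations -/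

/-- The number of variables quantified in the first `t` rounds, in which `m + 1` pairs each are
chosen. -/
def ctx : ℕ → ℕ
  | 0 => 0
  | t + 1 => ctx t + N.r + (N.r' + N.m * (N.r + N.r'))

theorem ctx_eq (t : ℕ) : N.ctx t = t * (N.m + 1) * (N.r + N.r') := by
  induction t with
  | zero => simp [ctx]
  | succ t ih =>
    rw [ctx, ih]
    ring

/-- The variables of the pair with number `a` in the context after round `t`. -/
def slot (t a : ℕ) (ha : a < (t + 1) * (N.m + 1)) (z : Fin N.r ⊕ Fin N.r') :
    Fin (N.ctx (t + 1)) :=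
  ⟨0 + a * (N.r + N.r') + finSumFinEquiv z, by
    have h : (a + 1) * (N.r + N.r') ≤ _ := Nat.mul_le_mul_right (N.r + N.r') ha
    rw [← ctx_eq, Nat.add_mul] at h
    have := (finSumFinEquiv z).isLt
    omega⟩

/-- The components of `t.unpair` are at most `t`, so the pairs that round `t` refers to have been
chosen by the end of that round, whatever `m` is. -/
theorem lt_rounds {t a : ℕ} (ha : a ≤ t) : a < (t + 1) * (N.m + 1) := by
  nlinarith [Nat.zero_le (t * N.m), Nat.zero_le N.m]

theorem new_lt_rounds {t a : ℕ} (ha : a < N.m + 1) :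
    t * (N.m + 1) + a < (t + 1) * (N.m + 1) := by
  rw [Nat.add_mul, Nat.one_mul]
  omega

/-- The requirement on round `t`: the new pairs satisfy `θ`, and the `i`-th of them after the first
witnesses the `i`-th independence atom for the two pairs whose numbers are coded by `t`. -/
def stage (t : ℕ) : L.BoundedFormula Empty (N.ctx (t + 1)) :=
  conj ((List.finRange (N.m + 1)).map fun (a : Fin (N.m + 1)) =>
    N.substθ (N.slot t (t * (N.m + 1) + a) (N.new_lt_rounds a.isLt))) ⊓
  conj ((List.finRange N.m).map fun (i : Fin N.m) =>
    let e (a : ℕ) (ha : a < (t + 1) * (N.m + 1)) (l : List (Fin N.r')) :=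
      l.map fun c => N.slot t a ha (Sum.inr c)
    let j := e t.unpair.1 (N.lt_rounds t.unpair_left_le)
    let k := e t.unpair.2 (N.lt_rounds t.unpair_right_le)
    let l := e (t * (N.m + 1) + (i + 1)) (N.new_lt_rounds (Nat.succ_lt_succ i.isLt))
    (eqTuple L (j (N.w i)) (k (N.w i))).imp
      (eqTuple L (j (N.u i)) (l (N.u i)) ⊓
        (eqTuple L (k (N.v i)) (l (N.v i)) ⊓ eqTuple L (j (N.w i)) (l (N.w i)))))

/-- `d` rounds, starting with round `t`, can be played. -/
def chain : (d t : ℕ) → L.BoundedFormula Empty (N.ctx t)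
  | 0, _ => ⊤
  | d + 1, t => N.block N.m (N.stage t ⊓ chain d (t + 1))

theorem realize_stage (t : ℕ) (V : ℕ → M) :
    (N.stage t).Realize default (restrict _ V) ↔
      (∀ a < N.m + 1, N.θ.Realize (N.pairAt V 0 (t * (N.m + 1) + a))) ∧
      ∀ i : Fin N.m, Agree (N.w i) (N.pairAt V 0 t.unpair.1) (N.pairAt V 0 t.unpair.2) →
        Agree (N.u i) (N.pairAt V 0 t.unpair.1) (N.pairAt V 0 (t * (N.m + 1) + (i + 1))) ∧
        Agree (N.v i) (N.pairAt V 0 t.unpair.2) (N.pairAt V 0 (t * (N.m + 1) + (i + 1))) ∧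
        Agree (N.w i) (N.pairAt V 0 t.unpair.1) (N.pairAt V 0 (t * (N.m + 1) + (i + 1))) := by
  rw [stage]
  simp only [BoundedFormula.realize_inf, BoundedFormula.realize_imp, realize_conj,
    List.forall_mem_map, List.mem_finRange, forall_const, realize_substθ, realize_eqTuple_map]
  exact and_congr_left' ⟨fun h a ha => h ⟨a, ha⟩, fun h a => h a a.isLt⟩

theorem realize_chain_succ (d t : ℕ) (V : ℕ → M) :
    (N.chain (d + 1) t).Realize default (restrict _ V) ↔
      ∀ x : Fin N.r → M, ∃ V' : ℕ → M, (∀ i < N.ctx t, V' i = V i) ∧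
        (∀ c : Fin N.r, V' (N.ctx t + c) = x c) ∧
        (N.stage t).Realize default (restrict _ V') ∧
        (N.chain d (t + 1)).Realize default (restrict _ V') := by
  refine (N.realize_block _ _ V).trans ?_
  refine forall_congr' fun x => exists_congr fun V' => ?_
  exact and_congr_right' (and_congr_right' BoundedFormula.realize_inf)

/-- Because the chains decrease in `d`, a finite part of the type used for saturation follows from
its last member. -/
theorem realize_chain_of_succ (d t : ℕ) (V : ℕ → M)
    (h : (N.chain (d + 1) t).Realize default (restrict _ V)) :
    (N.chain d t).Realize default (restrict _ V) := by
  induction d generalizing t V with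
  | zero => exact BoundedFormula.realize_top.2 trivial
  | succ d ih =>
    rw [realize_chain_succ] at h ⊢
    intro x
    obtain ⟨V', h1, h2, h3, h4⟩ := h x
    exact ⟨V', h1, h2, h3, ih _ _ h4⟩

theorem pairAt_ctx {M : Type w} (V : ℕ → M) (t a : ℕ) :
    N.pairAt V (N.ctx t) a = N.pairAt V 0 (t * (N.m + 1) + a) := by
  funext z
  rw [pairAt, pairAt, ctx_eq, Nat.zero_add, Nat.add_mul (t * (N.m + 1))]

theorem pairAt_congr_ctx {M : Type w} {V V' : ℕ → M} {t a : ℕ} (h : ∀ i < N.ctx t, V' i = V i)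
    (ha : a < t * (N.m + 1)) : N.pairAt V' 0 a = N.pairAt V 0 a := by
  refine N.pairAt_congr h ?_
  rw [ctx_eq, Nat.zero_add]
  exact Nat.mul_le_mul_right _ ha

/-- Simulation: the play `V` of the scheduled game is answered from a play `U` of the approximation.
The invariant `hUV` says that all pairs in `V` occur at the current level of `U`; one level supplies
the answers for one round. -/
theorem realize_chain_of_approxFrom (d t n : ℕ) (U V : ℕ → M)
    (hU : (N.approxFrom d (n + 1)).Realize default (restrict _ U))
    (hUV : ∀ a < t * (N.m + 1), ∃ b < N.len n, N.pairAt V 0 a = N.pairAt U (N.off n) b) :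
    (N.chain d t).Realize default (restrict _ V) := by
  induction d generalizing t n U V with
  | zero => exact BoundedFormula.realize_top.2 trivial
  | succ d ih =>
    rw [realize_chain_succ]
    intro x
    obtain ⟨U', hU1, hU2, hU3⟩ := (N.realize_block _ _ U).1 hU x
    obtain ⟨hpsi, happrox⟩ := BoundedFormula.realize_inf.1 hU3
    obtain ⟨hθ, hold, hind⟩ := (N.realize_psi_succ n U').1 hpsi
    have hle : N.p n + (n + 1) < N.len (n + 1) := by
      have h : N.p n ≤ N.p (n + 1) := Nat.le_add_right _ _
      simp only [len]
      omega
    obtain ⟨P, hP⟩ : ∃ P, P = N.pairAt U' (N.off (n + 1)) := ⟨_, rfl⟩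
    -- Pairs of earlier rounds move up by one, and the answer to `x` has number `0`; all stay in the
    -- range for which `psi` guarantees witnesses. The claim covers every continuation `V'`, because
    -- the actual one depends on the witnesses found next.
    have hpos : ∀ a ≤ t * (N.m + 1), ∃ b ≤ N.p n + (n + 1),
        ∀ V' : ℕ → M, (∀ i < N.ctx t, V' i = V i) → N.pairAt V' (N.ctx t) 0 = P 0 →
          N.pairAt V' 0 a = P b := by
      intro a ha
      rcases ha.lt_or_eq with ha | rfl
      · obtain ⟨b, hb, h⟩ := hUV a ha
        refine ⟨b + 1, ?_, fun V' hV' _ => ?_⟩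
        · simp only [len] at hb
          omega
        · rw [N.pairAt_congr_ctx hV' ha, h, hP, hold b hb]
          exact (N.pairAt_congr hU1 (N.pair_end_le n b hb)).symm
      · refine ⟨0, Nat.zero_le _, fun V' _ hV' => ?_⟩
        rw [← hV', pairAt_ctx]
        rfl
    have hunpair : ∀ a ≤ t, a ≤ t * (N.m + 1) := fun a ha => by nlinarith [Nat.zero_le (t * N.m)]
    obtain ⟨j, hj, hj'⟩ := hpos t.unpair.1 (hunpair _ t.unpair_left_le)
    obtain ⟨k, hk, hk'⟩ := hpos t.unpair.2 (hunpair _ t.unpair_right_le)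
    have hT : ∀ i : Fin N.m, ∃ l < N.len (n + 1), Agree (N.w i) (P j) (P k) →
        Agree (N.u i) (P j) (P l) ∧ Agree (N.v i) (P k) (P l) ∧ Agree (N.w i) (P j) (P l) := by
      intro i
      by_cases h : Agree (N.w i) (P j) (P k)
      · subst hP
        obtain ⟨l, hl, -, h'⟩ := hind i j hj k hk h
        exact ⟨l, hl, fun _ => h'⟩
      · exact ⟨0, Nat.succ_pos _, fun h' => absurd h' h⟩
    choose T hT hT' using hT
    -- Place `0` of the round copies the answer to `x`, place `i + 1` the witness for atom `i`;
    -- later values are irrelevant.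
    obtain ⟨q, hq⟩ : ∃ q : ℕ → ℕ,
      q = fun a => if h : a - 1 < N.m ∧ a ≠ 0 then T ⟨a - 1, h.1⟩ else 0 := ⟨_, rfl⟩
    have hq0 : q 0 = 0 := by simp [hq]
    have hq1 : ∀ i : Fin N.m, q (i + 1) = T i := fun i => by simp [hq]
    have hqlt : ∀ a, q a < N.len (n + 1) := by
      intro a
      rw [hq]
      dsimp only
      split_ifs
      exacts [hT _, Nat.succ_pos _]
    obtain ⟨V', hV1, hV2⟩ := N.exists_pairAt_eq (N.ctx t) V fun a => P (q a)
    have hV0 : N.pairAt V' (N.ctx t) 0 = P 0 := by rw [hV2, hq0]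
    have hnew : ∀ a, N.pairAt V' 0 (t * (N.m + 1) + a) = P (q a) := fun a => by
      rw [← pairAt_ctx, hV2]
    refine ⟨V', hV1, fun c => ?_, ?_, ih (t + 1) (n + 1) U' V' happrox ?_⟩
    · rw [← N.pairAt_inl V', hV0, hP, pairAt_inl, hU2]
    · rw [realize_stage]
      refine ⟨fun a _ => ?_, fun i => ?_⟩
      · rw [hnew, hP]
        exact hθ _ (hqlt a)
      · rw [hnew, hq1, hj' V' hV1 hV0, hk' V' hV1 hV0]
        exact hT' i
    · intro a ha
      rw [← hP]
      rcases Nat.lt_or_ge a (t * (N.m + 1)) with h | h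
      · obtain ⟨b, hb, hb'⟩ := hpos a h.le
        exact ⟨b, by omega, hb' V' hV1 hV0⟩
      · obtain ⟨a, rfl⟩ := Nat.exists_eq_add_of_le h
        exact ⟨q a, hqlt a, hnew a⟩

/-- The simulation needs a level before its first round, so level `0` is spent on an arbitrary `x`
and round `t` is answered by level `t + 1`. -/
theorem realize_chain_of_approx [Nonempty M] (h : ∀ n, Sentence.Realize M (N.approx n)) (d : ℕ)
    (V : ℕ → M) : (N.chain d 0).Realize default (restrict _ V) := by
  have h := (N.realize_approx_iff (d + 1) V).1 (h (d + 1))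
  obtain ⟨U, -, -, hU⟩ := (N.realize_block _ _ V).1 h fun _ => Classical.arbitrary M
  exact N.realize_chain_of_approxFrom d 0 0 U V (BoundedFormula.realize_inf.1 hU).2
    fun a ha => absurd ha (by simp)

end NormalForm

/-! ### Gödel numbers of uniform sequences of formulas -/

namespace GodelNumbering

variable (G : GodelNumbering L)

/-- The syntax tree is fixed and only the variable numbers at its leaves depend on `d`, so finitely
many compositions suffice. -/
theorem primrec_termCode_relabel {α : Type*} {n : ℕ → ℕ} {f : ∀ d, α → Fin (n d)}
    (hf : ∀ a, Primrec fun d => (f d a : ℕ)) (t : L.Term (α ⊕ Fin 0)) :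
    Primrec fun d => G.termCode (t.relabel
      (BoundedFormula.relabelAux (fun a => (Sum.inr (f d a) : Empty ⊕ Fin (n d))) 0)) := by
  induction t with
  | var a =>
    rcases a with a | a
    · exact Primrec₂.natPair.comp (Primrec.const 0) (hf a)
    · exact a.elim0
  | func F ts ih =>
    exact Primrec₂.natPair.comp (Primrec.const 1) (Primrec₂.natPair.comp (Primrec.const _)
      (Primrec.encode.comp (Primrec.list_ofFn ih)))

theorem primrec_code_imp {n : ℕ → ℕ} {φ ψ : ∀ d, L.BoundedFormula Empty (n d)}
    (hφ : Primrec fun d => G.code (φ d)) (hψ : Primrec fun d => G.code (ψ d)) :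
    Primrec fun d => G.code ((φ d).imp (ψ d)) :=
  Primrec₂.natPair.comp (Primrec.const 3) (Primrec₂.natPair.comp hφ hψ)

theorem primrec_code_not {n : ℕ → ℕ} {φ : ∀ d, L.BoundedFormula Empty (n d)}
    (hφ : Primrec fun d => G.code (φ d)) : Primrec fun d => G.code (φ d).not :=
  G.primrec_code_imp hφ (Primrec.const _)

theorem primrec_code_inf {n : ℕ → ℕ} {φ ψ : ∀ d, L.BoundedFormula Empty (n d)}
    (hφ : Primrec fun d => G.code (φ d)) (hψ : Primrec fun d => G.code (ψ d)) :
    Primrec fun d => G.code (φ d ⊓ ψ d) :=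
  G.primrec_code_not (G.primrec_code_imp hφ (G.primrec_code_not hψ))

theorem primrec_code_all {n : ℕ → ℕ} {φ : ∀ d, L.BoundedFormula Empty (n d + 1)}
    (hφ : Primrec fun d => G.code (φ d)) : Primrec fun d => G.code (φ d).all :=
  Primrec₂.natPair.comp (Primrec.const 4) hφ

theorem primrec_code_ex {n : ℕ → ℕ} {φ : ∀ d, L.BoundedFormula Empty (n d + 1)}
    (hφ : Primrec fun d => G.code (φ d)) : Primrec fun d => G.code (φ d).ex :=
  G.primrec_code_not (G.primrec_code_all (G.primrec_code_not hφ))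

theorem primrec_code_conj {ι : Type*} {n : ℕ → ℕ} (l : List ι)
    {φ : ∀ d, ι → L.BoundedFormula Empty (n d)} (hφ : ∀ i, Primrec fun d => G.code (φ d i)) :
    Primrec fun d => G.code (conj (l.map (φ d))) := by
  induction l with
  | nil => exact Primrec.const _
  | cons i l ih => exact G.primrec_code_inf (hφ i) ih

theorem primrec_code_eqTuple {ι : Type*} {n : ℕ → ℕ} (e : List ι) {f g : ∀ d, ι → Fin (n d)}
    (hf : ∀ i, Primrec fun d => (f d i : ℕ)) (hg : ∀ i, Primrec fun d => (g d i : ℕ)) :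
    Primrec fun d => G.code (eqTuple L (e.map (f d)) (e.map (g d))) := by
  simp only [eqTuple, List.zip_map', List.map_map]
  refine G.primrec_code_conj e fun i => ?_
  exact Primrec₂.natPair.comp (Primrec.const 1) (Primrec₂.natPair.comp
    (Primrec₂.natPair.comp (Primrec.const 0) (hf i))
    (Primrec₂.natPair.comp (Primrec.const 0) (hg i)))

theorem primrec_code_relabel {α : Type*} {n : ℕ → ℕ} {f : ∀ d, α → Fin (n d)}
    (hf : ∀ a, Primrec fun d => (f d a : ℕ)) {φ : L.BoundedFormula α 0} (hφ : φ.IsQF) :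
    Primrec fun d => G.code (BoundedFormula.relabel (n := n d) (k := 0)
      (fun a => (Sum.inr (f d a) : Empty ⊕ Fin (n d))) φ) := by
  induction hφ with
  | falsum => exact Primrec.const _
  | of_isAtomic h =>
    cases h with
    | equal t₁ t₂ =>
      exact Primrec₂.natPair.comp (Primrec.const 1) (Primrec₂.natPair.comp
        (G.primrec_termCode_relabel hf t₁) (G.primrec_termCode_relabel hf t₂))
    | rel R ts =>
      exact Primrec₂.natPair.comp (Primrec.const 2) (Primrec₂.natPair.comp (Primrec.const _)
        (Primrec.encode.comp (Primrec.list_ofFn fun i => G.primrec_termCode_relabel hf (ts i))))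
  | imp _ _ h₁ h₂ => exact Primrec₂.natPair.comp (Primrec.const 3) (Primrec₂.natPair.comp h₁ h₂)

/-! ### Gödel numbers and quantifier prefixes -/

/-- The code of the quantified formula depends only on that of its body, not on the context, so one
function `f` serves all rounds. -/
theorem exists_primrec_code_allsLast (k : ℕ) : ∃ f : ℕ → ℕ, Primrec f ∧ (∀ c, c ≤ f c) ∧
    ∀ {n : ℕ} (φ : L.BoundedFormula Empty (n + k)), G.code (allsLast k φ) = f (G.code φ) := by
  induction k with
  | zero => exact ⟨id, Primrec.id, fun _ => le_rfl, fun _ => rfl⟩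
  | succ k ih =>
    obtain ⟨f, hf, hle, h⟩ := ih
    refine ⟨fun c => f (Nat.pair 4 c),
      hf.comp (Primrec₂.natPair.comp (Primrec.const 4) Primrec.id),
      fun c => (Nat.right_le_pair 4 c).trans (hle _), fun φ => ?_⟩
    rw [allsLast, h]
    rfl

theorem le_code_not {n : ℕ} (φ : L.BoundedFormula Empty n) : G.code φ ≤ G.code φ.not :=
  (Nat.left_le_pair _ _).trans (Nat.right_le_pair _ _)

theorem le_code_ex {n : ℕ} (φ : L.BoundedFormula Empty (n + 1)) : G.code φ ≤ G.code φ.ex :=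
  ((G.le_code_not φ).trans (Nat.right_le_pair 4 _)).trans (G.le_code_not φ.not.all)

/-- Strictness makes the code grow with every round, which gives `d ≤ G.code (N.chain d t)`. -/
theorem code_lt_code_inf {n : ℕ} (φ ψ : L.BoundedFormula Empty n) :
    G.code ψ < G.code (φ ⊓ ψ) := by
  have h1 : G.code ψ.not < G.code (φ.imp ψ.not) := by
    refine lt_of_le_of_lt (Nat.right_le_pair (G.code φ) _) ?_
    refine lt_of_lt_of_le ?_ (Nat.add_le_pair 3 _)
    omega
  exact ((G.le_code_not ψ).trans_lt h1).trans_le (G.le_code_not _)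

theorem exists_primrec_code_exsLast (k : ℕ) : ∃ f : ℕ → ℕ, Primrec f ∧ (∀ c, c ≤ f c) ∧
    ∀ {n : ℕ} (φ : L.BoundedFormula Empty (n + k)), G.code (exsLast k φ) = f (G.code φ) := by
  induction k with
  | zero => exact ⟨id, Primrec.id, fun _ => le_rfl, fun _ => rfl⟩
  | succ k ih =>
    obtain ⟨f, hf, hle, h⟩ := ih
    have hnot : Primrec fun c => Nat.pair 3 (Nat.pair c (Nat.pair 0 0)) :=
      Primrec₂.natPair.comp (Primrec.const 3) (Primrec₂.natPair.comp Primrec.id (Primrec.const _))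
    have hle' : ∀ c, c ≤ Nat.pair 3 (Nat.pair c (Nat.pair 0 0)) := fun c =>
      (Nat.left_le_pair _ _).trans (Nat.right_le_pair _ _)
    refine ⟨fun c => f _, hf.comp (hnot.comp (Primrec₂.natPair.comp (Primrec.const 4) hnot)),
      fun c => ((hle' c).trans (Nat.right_le_pair 4 _)).trans ((hle' _).trans (hle _)), fun φ => ?_⟩
    rw [exsLast, h]
    rfl

/-- A sequence of formulas with primitive recursive and unbounded Gödel numbers. -/
structure IsUniform {n : ℕ} (φ : ℕ → L.BoundedFormula Empty n) : Prop where
  primrec : Primrec fun d => G.code (φ d)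
  le_code : ∀ d, d ≤ G.code (φ d)

variable {G}

theorem IsUniform.ex {n : ℕ} {φ : ℕ → L.BoundedFormula Empty (n + 1)} (h : G.IsUniform φ) :
    G.IsUniform fun d => (φ d).ex :=
  ⟨G.primrec_code_ex h.primrec, fun d => (h.le_code d).trans (G.le_code_ex _)⟩

/-- Since `d ≤ G.code (φ d)`, only indices up to `c` need be searched to decide whether `c` is a
code. -/
theorem IsUniform.isRecursive {n : ℕ} {φ : ℕ → L.BoundedFormula Empty n} (h : G.IsUniform φ) :
    G.IsRecursive (Set.range φ) := by
  have h1 : PrimrecRel fun d c : ℕ => G.code (φ d) = c :=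
    Primrec.eq.comp (h.primrec.comp Primrec.fst) Primrec.snd
  have h2 : PrimrecRel fun b c : ℕ => ∃ d < b, G.code (φ d) = c := PrimrecRel.exists_lt h1
  have h3 : PrimrecPred fun c : ℕ => ∃ d < c + 1, G.code (φ d) = c :=
    h2.comp Primrec.succ Primrec.id
  refine h3.computablePred.of_eq fun c => ?_
  constructor
  · rintro ⟨d, -, hd⟩
    exact ⟨_, ⟨d, rfl⟩, hd⟩
  · rintro ⟨_, ⟨d, rfl⟩, hd⟩
    exact ⟨d, Nat.lt_succ_of_le (hd ▸ h.le_code d), hd⟩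

end GodelNumbering

/-! ### Saturation for several variables -/

/-- A decreasing sequence of formulas that are satisfiable with the values `s` of their first `n`
variables is satisfiable by one assignment that extends `s`. -/
theorem exists_append_realize {Q : ∀ n, (ℕ → L.BoundedFormula Empty n) → Prop}
    (hex : ∀ n φ, Q (n + 1) φ → Q n fun d => (φ d).ex)
    (hsat : ∀ n φ, Q (n + 1) φ → ∀ s : Fin n → M,
      (∀ d, ∃ a : M, ∀ c ≤ d, (φ c).Realize default (Fin.snoc s a : Fin (n + 1) → M)) →
        ∃ a : M, ∀ d, (φ d).Realize default (Fin.snoc s a : Fin (n + 1) → M))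
    {n : ℕ} (k : ℕ) (φ : ℕ → L.BoundedFormula Empty (n + k)) (hφ : Q (n + k) φ)
    (hanti : ∀ d (t : Fin (n + k) → M), (φ (d + 1)).Realize default t → (φ d).Realize default t)
    (s : Fin n → M) (h : ∀ d, (exsLast k (φ d)).Realize default s) :
    ∃ x : Fin k → M, ∀ d, (φ d).Realize default (Fin.append s x) := by
  induction k with
  | zero =>
    refine ⟨default, fun d => ?_⟩
    rw [Fin.append_right_nil _ _ rfl]
    exact h d
  | succ k ih =>
    -- The first `k` values realize all the formulas with the last variable quantified away; `hsat`
    -- then supplies that variable, monotonicity giving the finite parts.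
    obtain ⟨x, hx⟩ := ih (fun d => (φ d).ex) (hex _ _ hφ) (fun d t ht => by
      rw [BoundedFormula.realize_ex] at ht ⊢
      exact ht.imp fun a => hanti d _) h
    obtain ⟨a, ha⟩ := hsat _ φ hφ (Fin.append s x) fun d => by
      obtain ⟨a, ha⟩ := BoundedFormula.realize_ex.1 (hx d)
      exact ⟨a, fun c hc => Nat.decreasingInduction' (fun k _ _ hk => hanti k _ hk) hc ha⟩
    refine ⟨Fin.snoc x a, fun d => ?_⟩
    rw [Fin.append_snoc]
    exact ha d

/-- Some element serves infinitely many `d`, hence all. -/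
theorem exists_forall_realize_of_finite [Finite M] {n : ℕ} (φ : ℕ → L.BoundedFormula Empty (n + 1))
    (s : Fin n → M)
    (h : ∀ d, ∃ a : M, ∀ c ≤ d, (φ c).Realize default (Fin.snoc s a : Fin (n + 1) → M)) :
    ∃ a : M, ∀ d, (φ d).Realize default (Fin.snoc s a : Fin (n + 1) → M) := by
  choose f hf using h
  obtain ⟨a, ha⟩ := Finite.exists_infinite_fiber f
  refine ⟨a, fun d => ?_⟩
  obtain ⟨e, he, hde⟩ := (Set.infinite_coe_iff.1 ha).exists_gt d
  have : f e = a := he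
  exact this ▸ hf e d hde.le

/-! ### From saturation to an infinite play of the scheduled game -/

namespace NormalForm

variable (N : NormalForm L)

theorem primrec_slot {a : ℕ → ℕ} (h : Primrec a) (ha : ∀ t, a t < (t + 1) * (N.m + 1))
    (z : Fin N.r ⊕ Fin N.r') : Primrec fun t => (N.slot t (a t) (ha t) z : ℕ) :=
  Primrec.nat_add.comp (Primrec.nat_add.comp (Primrec.const 0)
    (Primrec.nat_mul.comp h (Primrec.const _))) (Primrec.const _)

theorem primrec_code_stage (G : GodelNumbering L) : Primrec fun t => G.code (N.stage t) := by
  have hnew : ∀ a, Primrec fun t => t * (N.m + 1) + a := fun a =>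
    Primrec.nat_add.comp (Primrec.nat_mul.comp Primrec.id (Primrec.const _)) (Primrec.const a)
  have hj : Primrec fun t : ℕ => t.unpair.1 := Primrec.fst.comp Primrec.unpair
  have hk : Primrec fun t : ℕ => t.unpair.2 := Primrec.snd.comp Primrec.unpair
  refine G.primrec_code_inf (G.primrec_code_conj _ fun a => ?_) (G.primrec_code_conj _ fun i => ?_)
  · exact G.primrec_code_relabel (fun z => N.primrec_slot (hnew a) _ z) N.isQF
  · have hj' := fun c => N.primrec_slot hj (fun t => N.lt_rounds t.unpair_left_le) (Sum.inr c)
    have hk' := fun c => N.primrec_slot hk (fun t => N.lt_rounds t.unpair_right_le) (Sum.inr c)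
    have hl' := fun c => N.primrec_slot (hnew (i + 1))
      (fun t => N.new_lt_rounds (Nat.succ_lt_succ i.isLt)) (Sum.inr c)
    exact G.primrec_code_imp (G.primrec_code_eqTuple _ hj' hk')
      (G.primrec_code_inf (G.primrec_code_eqTuple _ hj' hl')
        (G.primrec_code_inf (G.primrec_code_eqTuple _ hk' hl') (G.primrec_code_eqTuple _ hj' hl')))

theorem isUniform_chain (G : GodelNumbering L) (t : ℕ) : G.IsUniform fun d => N.chain d t := by
  obtain ⟨f, hf, hfle, hfc⟩ := G.exists_primrec_code_allsLast N.r
  obtain ⟨g, hg, hgle, hgc⟩ := G.exists_primrec_code_exsLast (N.r' + N.m * (N.r + N.r'))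
  have hcode : ∀ d t, G.code (N.chain (d + 1) t) =
      f (g (G.code (N.stage t ⊓ N.chain d (t + 1)))) := fun d t => by
    rw [chain, block, hfc, hgc]
    rfl
  constructor
  · obtain ⟨F, hF⟩ : ∃ F : ℕ → ℕ → ℕ, F = fun a c => f (g (Nat.pair 3 (Nat.pair
        (Nat.pair 3 (Nat.pair a (Nat.pair 3 (Nat.pair c (Nat.pair 0 0))))) (Nat.pair 0 0)))) :=
      ⟨_, rfl⟩
    have hFp : Primrec₂ F := by
      have hnot : Primrec fun c => Nat.pair 3 (Nat.pair c (Nat.pair 0 0)) :=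
        Primrec₂.natPair.comp (Primrec.const 3)
          (Primrec₂.natPair.comp Primrec.id (Primrec.const _))
      rw [hF]
      exact hf.comp (hg.comp (hnot.comp (Primrec₂.natPair.comp (Primrec.const 3)
        (Primrec₂.natPair.comp Primrec.fst (hnot.comp Primrec.snd)))))
    have hFcode : ∀ d t, G.code (N.chain (d + 1) t) =
        F (G.code (N.stage t)) (G.code (N.chain d (t + 1))) := fun d t => by
      rw [hcode, hF]
      rfl
    obtain ⟨S, hS⟩ : ∃ S : ℕ → ℕ, ∀ t, G.code (N.stage t) = S t := ⟨_, fun _ => rfl⟩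
    have hSp : Primrec S := (N.primrec_code_stage G).of_eq hS
    -- The recursion lowers `d` while raising `t`; unrolled as a fold over `List.range d`, it is
    -- primitive recursive in `d` for fixed `t`. The code of `⊤` is the same in every context.
    have hfold : ∀ d t, G.code (N.chain d t) =
        (List.range d).foldr (fun i c => F (S (t + i)) c)
          (G.code (⊤ : L.BoundedFormula Empty 0)) := by
      intro d
      induction d with
      | zero => exact fun t => rfl
      | succ d ih =>
        intro t
        have e : (fun i c => F (S (t + Nat.succ i)) c) = fun i c => F (S (t + 1 + i)) c := by
          funext i c
          rw [Nat.succ_eq_add_one, Nat.add_right_comm, Nat.add_assoc]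
        rw [List.range_succ_eq_map, List.foldr_cons, List.foldr_map, hFcode, hS, ih, e]
        rfl
    simp only [hfold]
    refine Primrec.list_foldr (h := fun _ (q : ℕ × ℕ) => F (S (t + q.1)) q.2)
      Primrec.list_range (Primrec.const _) ?_
    exact hFp.comp (hSp.comp (Primrec.nat_add.comp (Primrec.const t)
      (Primrec.fst.comp Primrec.snd))) (Primrec.snd.comp Primrec.snd)
  · intro d
    induction d generalizing t with
    | zero => exact Nat.zero_le _
    | succ d ih =>
      rw [hcode]
      exact ((ih (t + 1)).trans_lt (G.code_lt_code_inf _ _)).trans_le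
        ((hgle _).trans (hfle _))

theorem isUniform_stage_inf_chain (G : GodelNumbering L) (t : ℕ) :
    G.IsUniform fun d => N.stage t ⊓ N.chain d (t + 1) :=
  ⟨G.primrec_code_inf (n := fun _ => _) (Primrec.const _) (N.isUniform_chain G (t + 1)).primrec,
    fun d => ((N.isUniform_chain G (t + 1)).le_code d).trans (G.code_lt_code_inf _ _).le⟩

/-- If arbitrarily many rounds can be played, the next round can be played so that this remains
true. -/
def Playable (M : Type w) [L.Structure M] : Prop :=
  ∀ (t : ℕ) (V : ℕ → M), (∀ d, (N.chain d t).Realize default (restrict _ V)) →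
    ∀ x : Fin N.r → M, ∃ V' : ℕ → M, (∀ i < N.ctx t, V' i = V i) ∧
      (∀ c : Fin N.r, V' (N.ctx t + c) = x c) ∧ (N.stage t).Realize default (restrict _ V') ∧
      ∀ d, (N.chain d (t + 1)).Realize default (restrict _ V')

/-- `Q` stands for the sequences to which saturation applies: uniform ones in the recursive case,
all of them in the finite case. -/
theorem playable_of_saturated {Q : ∀ n, (ℕ → L.BoundedFormula Empty n) → Prop}
    (hQ : ∀ t, Q (N.ctx (t + 1)) fun d => N.stage t ⊓ N.chain d (t + 1))
    (hex : ∀ n φ, Q (n + 1) φ → Q n fun d => (φ d).ex)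
    (hsat : ∀ n φ, Q (n + 1) φ → ∀ s : Fin n → M,
      (∀ d, ∃ a : M, ∀ c ≤ d, (φ c).Realize default (Fin.snoc s a : Fin (n + 1) → M)) →
        ∃ a : M, ∀ d, (φ d).Realize default (Fin.snoc s a : Fin (n + 1) → M)) :
    N.Playable M := by
  intro t V hV x
  obtain ⟨y, hy⟩ := exists_append_realize (M := M) hex hsat
    (n := N.ctx t + N.r) (N.r' + N.m * (N.r + N.r'))
    (fun d => N.stage t ⊓ N.chain d (t + 1)) (hQ t)
    (fun d s h => by
      obtain ⟨V', rfl⟩ := exists_restrict_eq V s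
      exact BoundedFormula.realize_inf.2 ⟨(BoundedFormula.realize_inf.1 h).1,
        N.realize_chain_of_succ _ _ V' (BoundedFormula.realize_inf.1 h).2⟩)
    (Fin.append (restrict _ V) x) (fun d => (realize_allsLast _ _ _).1 (hV (d + 1)) x)
  obtain ⟨V', hV', h1, h2⟩ := append_append_restrict _ _ _ V x y
  rw [← hV'] at hy
  exact ⟨V', h1, h2, (BoundedFormula.realize_inf.1 (hy 0)).1,
    fun d => (BoundedFormula.realize_inf.1 (hy d)).2⟩

theorem playable_of_recursivelySaturated {G : GodelNumbering L}
    (hG : G.RecursivelySaturated M) : N.Playable M :=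
  N.playable_of_saturated (Q := fun _ φ => G.IsUniform φ) (N.isUniform_stage_inf_chain G)
    (fun _ _ h => h.ex) fun n φ hφ => hG n φ hφ.isRecursive

theorem playable_of_finite [Finite M] : N.Playable M :=
  N.playable_of_saturated (Q := fun _ _ => True) (fun _ => trivial) (fun _ _ _ => trivial)
    fun _ φ _ => exists_forall_realize_of_finite φ

variable {N}

/-- The pairs chosen in an infinite play in which every tuple `x` occurs form a witness. -/
theorem Playable.exists_isWitness [Countable M] [Nonempty M] (h : N.Playable M)
    (h0 : ∀ (V : ℕ → M) d, (N.chain d 0).Realize default (restrict _ V)) :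
    ∃ X, N.IsWitness (M := M) X := by
  obtain ⟨x, hx⟩ := exists_surjective_nat (Fin N.r → M)
  choose! next hnext1 hnext2 hnext3 hnext4 using h
  -- The infinite play: round `t` is challenged with `x t`, and by `hW` all finite games remain
  -- winnable.
  let W : ℕ → ℕ → M := fun t =>
    Nat.rec (fun _ => Classical.arbitrary M) (fun t V => next t V (x t)) t
  have hW : ∀ t d, (N.chain d t).Realize default (restrict _ (W t)) := by
    intro t
    induction t with
    | zero => exact h0 _
    | succ t ih => exact hnext4 t (W t) ih (x t)
  have hmono : Monotone N.ctx := monotone_nat_of_le_succ fun t => by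
    simp only [ctx]
    omega
  have hWle : ∀ s t, s ≤ t → ∀ i < N.ctx s, W t i = W s i := by
    intro s t hst
    induction t, hst using Nat.le_induction with
    | base => exact fun _ _ => rfl
    | succ t hst ih =>
      intro i hi
      rw [← ih i hi]
      exact hnext1 t (W t) (hW t) (x t) i (hi.trans_le (hmono hst))
  -- Positions once filled never change, so the stages have a limit; pair `a` is settled after `a +
  -- 1` rounds.
  obtain ⟨P, hP⟩ : ∃ P : ℕ → Fin N.r ⊕ Fin N.r' → M,
    ∀ t, ∀ a < t * (N.m + 1), N.pairAt (W t) 0 a = P a := by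
    refine ⟨fun a => N.pairAt (W (a + 1)) 0 a, fun t a ha => ?_⟩
    have ha' : a < (a + 1) * (N.m + 1) := N.lt_rounds le_rfl
    rcases le_total t (a + 1) with h | h
    · exact (N.pairAt_congr_ctx (hWle _ _ h) ha).symm
    · exact N.pairAt_congr_ctx (hWle _ _ h) ha'
  have hstage := fun t => (N.realize_stage t _).1 (hnext3 t (W t) (hW t) (x t))
  refine ⟨Set.range P, ?_, ?_, ?_⟩
  · intro y
    obtain ⟨t, rfl⟩ := hx y
    refine ⟨_, ⟨t * (N.m + 1) + 0, rfl⟩, fun c => ?_⟩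
    rw [← hP (t + 1) _ (N.new_lt_rounds (Nat.succ_pos _)), ← pairAt_ctx, pairAt_inl]
    exact hnext2 t (W t) (hW t) (x t) c
  · rintro _ ⟨a, rfl⟩
    have h := (hstage (a / (N.m + 1))).1 (a % (N.m + 1)) (Nat.mod_lt _ (Nat.succ_pos _))
    rw [Nat.div_add_mod'] at h
    rw [← hP (a / (N.m + 1) + 1) a (by
      rw [Nat.add_mul, Nat.one_mul]
      exact Nat.lt_div_mul_add (Nat.succ_pos _))]
    exact h
  · rintro i _ ⟨j, rfl⟩ _ ⟨k, rfl⟩ hw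
    have hj := Nat.left_le_pair j k
    have hk := Nat.right_le_pair j k
    have h := (hstage (Nat.pair j k)).2 i
    rw [Nat.unpair_pair] at h
    -- Round `Nat.pair j k` treats the couple `(j, k)`; its first new pair answers the challenge,
    -- hence the offset `i + 1`.
    refine ⟨_, ⟨Nat.pair j k * (N.m + 1) + (i + 1), rfl⟩, ?_⟩
    rw [← hP (Nat.pair j k + 1) j (N.lt_rounds hj), ← hP (Nat.pair j k + 1) k (N.lt_rounds hk)] at hw
    rw [← hP (Nat.pair j k + 1) j (N.lt_rounds hj), ← hP (Nat.pair j k + 1) k (N.lt_rounds hk),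
      ← hP (Nat.pair j k + 1) _ (N.new_lt_rounds (Nat.succ_lt_succ i.isLt))]
    exact h hw

theorem Playable.trueIn_iff [Countable M] [Nonempty M] (h : N.Playable M) :
    N.toIFormula.TrueIn M ↔ ∀ n : ℕ, Sentence.Realize M (N.approx n) := by
  rw [N.trueIn_iff]
  constructor
  · rintro ⟨X, hX⟩ n
    rw [N.realize_approx_iff n fun _ => Classical.arbitrary M]
    exact hX.realize_approxFrom n 0 _ fun m hm => absurd hm (Nat.succ_ne_zero m).symm
  · exact fun h' => h.exists_isWitness fun V d => N.realize_chain_of_approx h' d V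

end NormalForm

end IndependenceLogic

theorem mainTheorem7 {L : FirstOrder.Language.{u, v}} (N : IndependenceLogic.NormalForm L)
    (M : Type w) [L.Structure M] [Nonempty M]
    (hM : (Countable M ∧ ∃ G : IndependenceLogic.GodelNumbering L, G.RecursivelySaturated M) ∨
      Finite M) :
    N.toIFormula.TrueIn M ↔ ∀ n : ℕ, FirstOrder.Language.Sentence.Realize M (N.approx n) := by
  rcases hM with ⟨_, G, hG⟩ | _
  · exact (N.playable_of_recursivelySaturated hG).trueIn_iff
  · exact N.playable_of_finite.trueIn_iff
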